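/- An (abstract) $\Sigma^*$-algebra is a $C^*$-algebra $\mathfrak A$, not necessarily unital, with a collection of pairs $((a_n),a)$ of a sequence and an element in $\mathfrak A$ (written $a_n\xrightarrow{\sigma}a$), for which there is a faithful representation $\pi:\mathfrak A\to B(\mathcal H)$ on a Hilbert space such that $\pi(\mathfrak A)$ acts nondegenerately and contains the limits in $B(\mathcal H)$ of its WOT-convergent sequences, and such that $a_n\xrightarrow{\sigma}a$ if and only if $\pi(a_n)\to\pi(a)$ in the weak operator topology. A $*$-isomorphism $\varphi:\mathfrak A\to\mathfrak B$ of $\Sigma^*$-algebras is a $\Sigma^*$-isomorphism if $\varphi$ and $\varphi^{-1}$ preserve $\sigma$-convergent sequences and their limits. A subset is $\sigma$-dense if the smallest set that contains it and contains the limits of its $\sigma$-convergent sequences is the whole algebra. A right (resp. left) $C^*$-module $\mathfrak X$ over $\mathfrak B$ is a $\Sigma^*$-module if, whenever $(x_n)$ is a sequence in $\mathfrak X$ such that $(\langle x_n|y\rangle)$ is $\sigma$-convergent for every $y\in\mathfrak X$, there is $x\in\mathfrak X$ with $\langle x_n|y\rangle\xrightarrow{\sigma}\langle x|y\rangle$ for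 every $y$; it is $\sigma$-full if the span of $\{\langle x|y\rangle: x,y\in\mathfrak X\}$ is $\sigma$-dense in $\mathfrak B$. An $\mathfrak A$-$\mathfrak B$ $\Sigma^*$-imprimitivity bimodule is an $\mathfrak A$-$\mathfrak B$ bimodule $\mathfrak X$ such that: (1) $\mathfrak X$ is a $\sigma$-full left $\Sigma^*$-module over $\mathfrak A$ and a $\sigma$-full right $\Sigma^*$-module over $\mathfrak B$; (2) ${}_{\mathfrak A}\langle x|y\rangle z=x\langle y|z\rangle_{\mathfrak B}$ for all $x,y,z\in\mathfrak X$; (3) for every sequence $(x_n)$ and every $x$ in $\mathfrak X$, ${}_{\mathfrak A}\langle x_n|y\rangle\xrightarrow{\sigma}{}_{\mathfrak A}\langle x|y\rangle$ for all $y\in\mathfrak X$ if and only if $\langle x_n|y\rangle_{\mathfrak B}\xrightarrow{\sigma}\langle x|y\rangle_{\mathfrak B}$ for all $y\in\mathfrak X$. If such a bimodule exists, $\mathfrak A$ and $\mathfrak B$ are called strongly $\Sigma^*$-Morita equivalent. **Proposition.** Let $\mathfrak A$ and $\mathfrak B$ be commutative $\Sigma^*$-algebras. Then $\mathfrak A$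 and $\mathfrak B$ are strongly $\Sigma^*$-Morita equivalent if and only if they are $\Sigma^*$-isomorphic. Moreover, for every $\mathfrak A$-$\mathfrak B$ $\Sigma^*$-imprimitivity bimodule $\mathfrak X$ there is a $\Sigma^*$-isomorphism $\varphi:\mathfrak A\to\mathfrak B$ with $ax=x\varphi(a)$ for all $a\in\mathfrak A$, $x\in\mathfrak X$, and it is determined by this formula: if $a\in\mathfrak A$ and $b\in\mathfrak B$ satisfy $ax=xb$ for all $x\in\mathfrak X$, then $b=\varphi(a)$. -/

import Mathlib

open Filter Topology

universe u v w

/-- A sequence of operators on a Hilbert space converges to `T` in the weak operator topology. -/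
def WOTTendsto {H : Type u} [NormedAddCommGroup H] [InnerProductSpace ℂ H]
    (b : ℕ → H →L[ℂ] H) (T : H →L[ℂ] H) : Prop :=
  Tendsto (fun n => ContinuousLinearMapWOT.ofCLM (σ := RingHom.id ℂ) (b n)) atTop
    (𝓝 (ContinuousLinearMapWOT.ofCLM (σ := RingHom.id ℂ) T))

/-- A concrete `Σ*`-algebra: a nondegenerate `C*`-subalgebra of `B(H)` that contains the limits of
its WOT-convergent sequences. -/
structure IsConcreteSigmaStarAlgebra {H : Type u} [NormedAddCommGroup H] [InnerProductSpace ℂ H]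
    [CompleteSpace H] (S : NonUnitalStarSubalgebra ℂ (H →L[ℂ] H)) : Prop where
  isClosed : IsClosed (S : Set (H →L[ℂ] H))
  nondegenerate : Dense (Submodule.span ℂ {η : H | ∃ T ∈ S, ∃ ξ : H, η = T ξ} : Set H)
  wot_seq_closed : ∀ (b : ℕ → H →L[ℂ] H) (T : H →L[ℂ] H),
    (∀ n, b n ∈ S) → WOTTendsto b T → T ∈ S

/-- The structure of an abstract `Σ*`-algebra on a (not necessarily unital) `C*`-algebra `A`: a
collection of pairs (sequence, limit), the `σ`-convergent sequences, which in some faithful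
representation onto a concrete `Σ*`-algebra are exactly the WOT-convergent sequences. -/
class SigmaStarAlgebra (A : Type u) [NonUnitalCStarAlgebra A] where
  /-- `SigmaTendsto a l` means that the sequence `a` is `σ`-convergent to `l`. -/
  SigmaTendsto : (ℕ → A) → A → Prop
  exists_faithful_rep : ∃ (H : Type u) (_ : NormedAddCommGroup H) (_ : InnerProductSpace ℂ H)
    (_ : CompleteSpace H) (π : A →⋆ₙₐ[ℂ] (H →L[ℂ] H)),
      Function.Injective π ∧
      IsConcreteSigmaStarAlgebra (NonUnitalStarAlgHom.range π) ∧
      ∀ (a : ℕ → A) (l : A), SigmaTendsto a l ↔ WOTTendsto (fun n => π (a n)) (π l)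

open SigmaStarAlgebra (SigmaTendsto)

section SigmaTopology

variable {A : Type u} [NonUnitalCStarAlgebra A] [SigmaStarAlgebra A]

/-- A set containing the limits of its `σ`-convergent sequences. -/
def IsSigmaClosed (S : Set A) : Prop :=
  ∀ (a : ℕ → A) (l : A), (∀ n, a n ∈ S) → SigmaTendsto a l → l ∈ S

/-- The smallest `σ`-closed set containing `S`. -/
def sigmaClosure (S : Set A) : Set A :=
  ⋂₀ {T : Set A | S ⊆ T ∧ IsSigmaClosed T}

/-- `S` is `σ`-dense: its `σ`-closure is everything. -/
def IsSigmaDense (S : Set A) : Prop :=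
  sigmaClosure S = Set.univ

/-- Maps that preserve `σ`-convergent sequences and their limits. -/
def SigmaContinuous {B : Type v} [NonUnitalCStarAlgebra B] [SigmaStarAlgebra B]
    (f : A → B) : Prop :=
  ∀ (a : ℕ → A) (l : A), SigmaTendsto a l → SigmaTendsto (fun n => f (a n)) (f l)

/-- A `*`-isomorphism is a `Σ*`-isomorphism if it and its inverse are `σ`-continuous. -/
structure IsSigmaStarIso {B : Type v} [NonUnitalCStarAlgebra B] [SigmaStarAlgebra B]
    (φ : A ≃⋆ₐ[ℂ] B) : Prop where
  continuous_toFun : SigmaContinuous φ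
  continuous_symm : SigmaContinuous φ.symm

end SigmaTopology

/-- A right `C*`-module structure over `B` on a complex vector space `X`: a right action of `B` and
a `B`-valued inner product, linear in the second variable, for whose norm
`x ↦ ‖⟨x|x⟩‖ ^ (1/2)` the space is complete. -/
structure RightCStarModule (B : Type v) [NonUnitalCStarAlgebra B] (X : Type w) [AddCommGroup X]
    [Module ℂ X] where
  /-- the action `(x, b) ↦ x b` -/
  act : X → B → X
  /-- the inner product `(x, y) ↦ ⟨x|y⟩` -/
  inner : X → X → B
  add_act : ∀ x y b, act (x + y) b = act x b + act y b
  act_add : ∀ x b c, act x (b + c) = act x b + act x c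
  act_mul : ∀ x b c, act x (b * c) = act (act x b) c
  smul_act : ∀ (z : ℂ) x b, act (z • x) b = z • act x b
  act_smul : ∀ (z : ℂ) x b, act x (z • b) = z • act x b
  inner_add_right : ∀ x y z, inner x (y + z) = inner x y + inner x z
  inner_smul_right : ∀ (z : ℂ) x y, inner x (z • y) = z • inner x y
  inner_act_right : ∀ x y b, inner x (act y b) = inner x y * b
  star_inner : ∀ x y, star (inner x y) = inner y x
  inner_self_positive : ∀ x, ∃ b : B, inner x x = star b * b
  inner_self_eq_zero : ∀ x, inner x x = 0 → x = 0
  complete : ∀ x : ℕ → X,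
    (∀ ε > 0, ∃ N, ∀ m ≥ N, ∀ n ≥ N, √‖inner (x m - x n) (x m - x n)‖ < ε) →
    ∃ l, Tendsto (fun n => √‖inner (x n - l) (x n - l)‖) atTop (𝓝 0)

/-- A left `C*`-module structure over `A` on a complex vector space `X`: a left action of `A` and
an `A`-valued inner product, linear in the first variable, for whose norm
`x ↦ ‖⟨x|x⟩‖ ^ (1/2)` the space is complete. -/
structure LeftCStarModule (A : Type u) [NonUnitalCStarAlgebra A] (X : Type w) [AddCommGroup X]
    [Module ℂ X] where
  /-- the action `(a, x) ↦ a x` -/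
  act : A → X → X
  /-- the inner product `(x, y) ↦ ⟨x|y⟩` -/
  inner : X → X → A
  act_add : ∀ a x y, act a (x + y) = act a x + act a y
  add_act : ∀ a b x, act (a + b) x = act a x + act b x
  mul_act : ∀ a b x, act (a * b) x = act a (act b x)
  act_smul : ∀ (z : ℂ) a x, act a (z • x) = z • act a x
  smul_act : ∀ (z : ℂ) a x, act (z • a) x = z • act a x
  inner_add_left : ∀ x y z, inner (x + y) z = inner x z + inner y z
  inner_smul_left : ∀ (z : ℂ) x y, inner (z • x) y = z • inner x y
  inner_act_left : ∀ a x y, inner (act a x) y = a * inner x y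
  star_inner : ∀ x y, star (inner x y) = inner y x
  inner_self_positive : ∀ x, ∃ a : A, inner x x = star a * a
  inner_self_eq_zero : ∀ x, inner x x = 0 → x = 0
  complete : ∀ x : ℕ → X,
    (∀ ε > 0, ∃ N, ∀ m ≥ N, ∀ n ≥ N, √‖inner (x m - x n) (x m - x n)‖ < ε) →
    ∃ l, Tendsto (fun n => √‖inner (x n - l) (x n - l)‖) atTop (𝓝 0)

namespace RightCStarModule

variable {B : Type v} [NonUnitalCStarAlgebra B] [SigmaStarAlgebra B] {X : Type w} [AddCommGroup X]
  [Module ℂ X]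

/-- `σ_B`-convergence of a sequence in `X`. -/
def ModSigmaTendsto (M : RightCStarModule B X) (x : ℕ → X) (l : X) : Prop :=
  ∀ y, SigmaTendsto (fun n => M.inner (x n) y) (M.inner l y)

/-- The `C*`-module is a right `Σ*`-module. -/
def IsSigmaModule (M : RightCStarModule B X) : Prop :=
  ∀ x : ℕ → X, (∀ y, ∃ b : B, SigmaTendsto (fun n => M.inner (x n) y) b) →
    ∃ l, ∀ y, SigmaTendsto (fun n => M.inner (x n) y) (M.inner l y)

/-- The span of the inner products is `σ`-dense in `B`. -/
def IsSigmaFull (M : RightCStarModule B X) : Prop :=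
  IsSigmaDense (Submodule.span ℂ {b : B | ∃ x y, b = M.inner x y} : Set B)

end RightCStarModule

namespace LeftCStarModule

variable {A : Type u} [NonUnitalCStarAlgebra A] [SigmaStarAlgebra A] {X : Type w} [AddCommGroup X]
  [Module ℂ X]

/-- `_Aσ`-convergence of a sequence in `X`. -/
def ModSigmaTendsto (M : LeftCStarModule A X) (x : ℕ → X) (l : X) : Prop :=
  ∀ y, SigmaTendsto (fun n => M.inner (x n) y) (M.inner l y)

/-- The `C*`-module is a left `Σ*`-module. -/
def IsSigmaModule (M : LeftCStarModule A X) : Prop :=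
  ∀ x : ℕ → X, (∀ y, ∃ a : A, SigmaTendsto (fun n => M.inner (x n) y) a) →
    ∃ l, ∀ y, SigmaTendsto (fun n => M.inner (x n) y) (M.inner l y)

/-- The span of the inner products is `σ`-dense in `A`. -/
def IsSigmaFull (M : LeftCStarModule A X) : Prop :=
  IsSigmaDense (Submodule.span ℂ {a : A | ∃ x y, a = M.inner x y} : Set A)

end LeftCStarModule

/-- The structure of an `A`-`B` `Σ*`-imprimitivity bimodule on a complex vector space `X`. -/
structure SigmaImprimitivityBimodule (A : Type u) (B : Type v) [NonUnitalCStarAlgebra A]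
    [SigmaStarAlgebra A] [NonUnitalCStarAlgebra B] [SigmaStarAlgebra B] (X : Type w)
    [AddCommGroup X] [Module ℂ X] where
  left : LeftCStarModule A X
  right : RightCStarModule B X
  act_act : ∀ a x b, right.act (left.act a x) b = left.act a (right.act x b)
  left_isSigmaModule : left.IsSigmaModule
  right_isSigmaModule : right.IsSigmaModule
  left_isSigmaFull : left.IsSigmaFull
  right_isSigmaFull : right.IsSigmaFull
  inner_act : ∀ x y z, left.act (left.inner x y) z = right.act x (right.inner y z)
  tendsto_iff : ∀ (x : ℕ → X) (l : X), left.ModSigmaTendsto x l ↔ right.ModSigmaTendsto x l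

/-- `A` and `B` are strongly `Σ*`-Morita equivalent: there is an `A`-`B` `Σ*`-imprimitivity
bimodule. -/
def StronglySigmaMoritaEquivalent (A : Type u) (B : Type v) [NonUnitalCStarAlgebra A]
    [SigmaStarAlgebra A] [NonUnitalCStarAlgebra B] [SigmaStarAlgebra B] : Prop :=
  ∃ (X : Type (max u v)) (_ : AddCommGroup X) (_ : Module ℂ X),
    Nonempty (SigmaImprimitivityBimodule A B X)

/-! Commutativity of both algebras forces `x⟨y|z⟩ = z⟨y|x⟩` (`act_inner_comm`), so the left inner
product of `x` and `y` acts on the module exactly as `⟨y|x⟩` acts from the right. Call `a` and `b`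
corresponding when `ax = xb` for all `x`. By `σ`-fullness `b` is unique, so the graph of this
relation is a closed `*`-subalgebra of `A × B` on which the first projection is injective, hence
isometric: `‖b‖ ≤ ‖a‖`.

The domain of the relation contains the span of the left inner products, so it is all of `A` once it
is `σ`-closed. If `aₙ → a` and `bₙ` corresponds to `aₙ`, condition (3) makes `bₙ⟨x|y⟩` converge; as
`(bₙ)` is bounded and the inner products span a `σ`-dense set, `(bₙ)` itself converges
(`exists_sigmaTendsto_of_norm_le`, `Corresponds.exists_sigmaTendsto`). This also shows that `a ↦ b`
is `σ`-continuous; exchanging the sides (`flip`) gives the inverse. Conversely, an isomorphism `φ`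
makes `A` itself a bimodule, with `B` acting through `φ⁻¹`. -/

/-! ### Boundedness and sequential completeness in the weak operator topology -/

section WeakOperatorTopology

variable {H : Type u} [NormedAddCommGroup H] [InnerProductSpace ℂ H]

theorem wotTendsto_iff [CompleteSpace H] {b : ℕ → H →L[ℂ] H} {T : H →L[ℂ] H} :
    WOTTendsto b T ↔
      ∀ x y, Tendsto (fun n => inner ℂ y (b n x)) atTop (𝓝 (inner ℂ y (T x))) :=
  ContinuousLinearMapWOT.tendsto_iff_forall_inner_apply_tendsto

/-- A sequence of operators with bounded matrix coefficients is bounded. -/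
theorem exists_norm_le_of_forall_norm_inner_le [CompleteSpace H] (b : ℕ → H →L[ℂ] H)
    (h : ∀ x y, ∃ C, ∀ n, ‖inner ℂ y (b n x)‖ ≤ C) : ∃ C, ∀ n, ‖b n‖ ≤ C := by
  refine banach_steinhaus fun x => ?_
  obtain ⟨C, hC⟩ := banach_steinhaus (g := fun n => innerSL ℂ (b n x)) fun y => by
    obtain ⟨C, hC⟩ := h x y
    exact ⟨C, fun n => by simpa [norm_inner_symm] using hC n⟩
  exact ⟨C, fun n => by simpa using hC n⟩

theorem WOTTendsto.exists_norm_le [CompleteSpace H] {b : ℕ → H →L[ℂ] H} {T : H →L[ℂ] H}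
    (h : WOTTendsto b T) : ∃ C, ∀ n, ‖b n‖ ≤ C := by
  refine exists_norm_le_of_forall_norm_inner_le b fun x y => ?_
  obtain ⟨C, hC⟩ := (wotTendsto_iff.1 h x y).norm.bddAbove_range
  exact ⟨C, fun n => hC ⟨n, rfl⟩⟩

/-- A bounded sequence of operators whose matrix coefficients are Cauchy on a total set is
WOT-convergent. -/
theorem exists_wotTendsto [CompleteSpace H] (b : ℕ → H →L[ℂ] H) (C : ℝ) (hC : ∀ n, ‖b n‖ ≤ C)
    (s : Set H) (hs : Dense (Submodule.span ℂ s : Set H))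
    (h : ∀ x ∈ s, ∀ y, CauchySeq fun n => inner ℂ y (b n x)) : ∃ T, WOTTendsto b T := by
  have hC0 : 0 ≤ C := (norm_nonneg _).trans (hC 0)
  have hspan : ∀ x ∈ Submodule.span ℂ s, ∀ y, CauchySeq fun n => inner ℂ y (b n x) := by
    intro x hx y
    induction hx using Submodule.span_induction with
    | mem x hx => exact h x hx y
    | zero => simpa using! cauchySeq_const (0 : ℂ)
    | add x z _ _ hx hz => simpa [inner_add_right] using! hx.add hz
    | smul c x _ hx =>
      simpa [inner_smul_right] using! (uniformContinuous_const_smul c).comp_cauchySeq hx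
  have hall : ∀ x y, CauchySeq fun n => inner ℂ y (b n x) := by
    intro x y
    rw [Metric.cauchySeq_iff']
    intro ε hε
    -- Three-epsilon argument: the uniform bound `C` controls the error of replacing `x` by `z`.
    obtain ⟨z, hz, hxz⟩ : ∃ z ∈ Submodule.span ℂ s, ‖y‖ * (C * ‖x - z‖) < ε / 3 := by
      have hcont : ContinuousAt (fun z => ‖y‖ * (C * ‖x - z‖)) x := by fun_prop
      have hev := hcont.eventually_lt_const (u := ε / 3) (by simp; positivity)
      obtain ⟨z, hz⟩ := (mem_closure_iff_frequently.1 (hs x)).and_eventually hev |>.exists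
      exact ⟨z, hz⟩
    obtain ⟨N, hN⟩ := Metric.cauchySeq_iff'.1 (hspan z hz y) (ε / 3) (by positivity)
    have hd : ∀ n, dist (inner ℂ y (b n x)) (inner ℂ y (b n z)) < ε / 3 := fun n => by
      rw [dist_eq_norm, ← inner_sub_right, ← map_sub]
      refine lt_of_le_of_lt ((norm_inner_le_norm _ _).trans ?_) hxz
      gcongr
      exact (b n).le_of_opNorm_le (hC n) _
    refine ⟨N, fun n hn => ?_⟩
    have h1 := hd n
    have h2 := hN n hn
    have h3 := hd N
    rw [dist_comm] at h3
    linarith [dist_triangle4 (inner ℂ y (b n x)) (inner ℂ y (b n z)) (inner ℂ y (b N z))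
      (inner ℂ y (b N x))]
  have hlim : ∀ x, ∃ v : H, ∀ y, Tendsto (fun n => inner ℂ y (b n x)) atTop (𝓝 (inner ℂ y v)) := by
    intro x
    have hex : ∀ y, ∃ l, Tendsto (fun n => innerSL ℂ (b n x) y) atTop (𝓝 l) := fun y => by
      refine cauchySeq_tendsto_of_complete ?_
      have := (Complex.isometry_conj.uniformContinuous.comp_cauchySeq (hall x y))
      simpa [Function.comp_def] using this
    choose f hf using hex
    let F : H →L[ℂ] ℂ := continuousLinearMapOfTendsto (fun n => innerSL ℂ (b n x))
      (tendsto_pi_nhds.2 hf)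
    refine ⟨(InnerProductSpace.toDual ℂ H).symm F, fun y => ?_⟩
    have h1 : inner ℂ ((InnerProductSpace.toDual ℂ H).symm F) y = f y :=
      InnerProductSpace.toDual_symm_apply
    have h2 := (Complex.continuous_conj.tendsto _).comp (hf y)
    rw [← h1] at h2
    simpa only [Function.comp_def, innerSL_apply_apply, inner_conj_symm] using h2
  choose T hT using hlim
  let L : H →ₗ[ℂ] H :=
    { toFun := T
      map_add' := fun x z => ext_inner_left ℂ fun y => by
        refine tendsto_nhds_unique (hT (x + z) y) ?_
        simpa [inner_add_right] using (hT x y).add (hT z y)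
      map_smul' := fun c x => ext_inner_left ℂ fun y => by
        refine tendsto_nhds_unique (hT (c • x) y) ?_
        simpa [inner_smul_right] using (hT x y).const_mul c }
  refine ⟨L.mkContinuous C fun x => ?_, wotTendsto_iff.2 hT⟩
  -- Testing the weak limit against `T x` itself gives `‖T x‖² ≤ ‖T x‖ C ‖x‖`; dividing by `‖T x‖`
  -- bounds `T`.
  have h1 : ‖inner ℂ (T x) (T x)‖ ≤ ‖T x‖ * (C * ‖x‖) := by
    refine le_of_tendsto (hT x (T x)).norm (Eventually.of_forall fun n => ?_)
    refine (norm_inner_le_norm _ _).trans ?_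
    gcongr
    exact (b n).le_of_opNorm_le (hC n) _
  rw [inner_self_eq_norm_sq_to_K] at h1
  change ‖T x‖ ≤ _
  rcases (norm_nonneg (T x)).eq_or_lt with h0 | h0
  · rw [← h0]; positivity
  · refine le_of_mul_le_mul_left ?_ h0
    simpa [sq] using h1

end WeakOperatorTopology

/-! ### `σ`-convergence in a `Σ*`-algebra -/

namespace SigmaStarAlgebra

variable {A : Type u} [NonUnitalCStarAlgebra A] [SigmaStarAlgebra A]

theorem SigmaTendsto.unique {a : ℕ → A} {l l' : A} (h : SigmaTendsto a l)
    (h' : SigmaTendsto a l') : l = l' := by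
  obtain ⟨H, _, _, _, π, hinj, -, hσ⟩ := SigmaStarAlgebra.exists_faithful_rep (A := A)
  rw [hσ, wotTendsto_iff] at h h'
  refine hinj (ContinuousLinearMap.ext fun x => ext_inner_left ℂ fun y => ?_)
  exact tendsto_nhds_unique (h x y) (h' x y)

theorem SigmaTendsto.star {a : ℕ → A} {l : A} (h : SigmaTendsto a l) :
    SigmaTendsto (fun n => star (a n)) (star l) := by
  obtain ⟨H, _, _, _, π, hinj, -, hσ⟩ := SigmaStarAlgebra.exists_faithful_rep (A := A)
  rw [hσ, wotTendsto_iff] at h ⊢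
  intro x y
  have := (Complex.continuous_conj.tendsto _).comp (h y x)
  simpa [Function.comp_def, map_star, ContinuousLinearMap.star_eq_adjoint,
    ContinuousLinearMap.adjoint_inner_right] using this

theorem SigmaTendsto.mul_const {a : ℕ → A} {l : A} (h : SigmaTendsto a l) (c : A) :
    SigmaTendsto (fun n => a n * c) (l * c) := by
  obtain ⟨H, _, _, _, π, hinj, -, hσ⟩ := SigmaStarAlgebra.exists_faithful_rep (A := A)
  rw [hσ, wotTendsto_iff] at h ⊢
  intro x y
  simpa [map_mul] using h (π c x) y

theorem SigmaTendsto.const_smul {a : ℕ → A} {l : A} (h : SigmaTendsto a l) (c : ℂ) :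
    SigmaTendsto (fun n => c • a n) (c • l) := by
  obtain ⟨H, _, _, _, π, hinj, -, hσ⟩ := SigmaStarAlgebra.exists_faithful_rep (A := A)
  rw [hσ, wotTendsto_iff] at h ⊢
  intro x y
  simpa [map_smul, inner_smul_right] using (h x y).const_mul c

theorem SigmaTendsto.add {a b : ℕ → A} {l m : A} (h : SigmaTendsto a l) (h' : SigmaTendsto b m) :
    SigmaTendsto (fun n => a n + b n) (l + m) := by
  obtain ⟨H, _, _, _, π, hinj, -, hσ⟩ := SigmaStarAlgebra.exists_faithful_rep (A := A)
  rw [hσ, wotTendsto_iff] at h h' ⊢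
  intro x y
  simpa [map_add, inner_add_right] using (h x y).add (h' x y)

theorem sigmaTendsto_of_tendsto {a : ℕ → A} {l : A} (h : Tendsto a atTop (𝓝 l)) :
    SigmaTendsto a l := by
  obtain ⟨H, _, _, _, π, hinj, -, hσ⟩ := SigmaStarAlgebra.exists_faithful_rep (A := A)
  rw [hσ, wotTendsto_iff]
  intro x y
  have hπ : Continuous π := (NonUnitalStarAlgHom.isometry π hinj).continuous
  have : Continuous fun a => inner ℂ y (π a x) := by fun_prop
  exact (this.tendsto l).comp h

theorem SigmaTendsto.exists_norm_le {a : ℕ → A} {l : A} (h : SigmaTendsto a l) :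
    ∃ C, ∀ n, ‖a n‖ ≤ C := by
  obtain ⟨H, _, _, _, π, hinj, -, hσ⟩ := SigmaStarAlgebra.exists_faithful_rep (A := A)
  obtain ⟨C, hC⟩ := ((hσ _ _).1 h).exists_norm_le
  exact ⟨C, fun n => by simpa [NonUnitalStarAlgHom.norm_map π hinj] using hC n⟩

theorem _root_.IsSigmaDense.mem_of_isSigmaClosed {S T : Set A} (hS : IsSigmaDense S) (hST : S ⊆ T)
    (hT : IsSigmaClosed T) (a : A) : a ∈ T := by
  have : a ∈ sigmaClosure S := hS ▸ Set.mem_univ a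
  exact Set.mem_sInter.1 this T ⟨hST, hT⟩

/-- The left annihilator of `b` is `σ`-closed, so it is everything and contains `star b`; then `star
b * b = 0`. -/
theorem eq_zero_of_forall_mul_eq_zero {S : Set A} (hS : IsSigmaDense S) {b : A}
    (hb : ∀ c ∈ S, c * b = 0) : b = 0 := by
  have h := hS.mem_of_isSigmaClosed (T := {c | c * b = 0}) hb (fun c l hc hl => by
    refine (hl.mul_const b).unique ?_
    simp only [show ∀ n, c n * b = 0 from hc]
    exact sigmaTendsto_of_tendsto tendsto_const_nhds) (Star.star b)
  exact CStarRing.star_mul_self_eq_zero_iff b |>.1 h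

/-- A bounded sequence that `σ`-converges after multiplication by the elements of a `σ`-dense set
is `σ`-convergent. -/
theorem exists_sigmaTendsto_of_norm_le {S : Set A} (hS : IsSigmaDense S) {b : ℕ → A} {C : ℝ}
    (hC : ∀ n, ‖b n‖ ≤ C) (hb : ∀ c ∈ S, ∃ l, SigmaTendsto (fun n => b n * c) l) :
    ∃ l, SigmaTendsto b l := by
  obtain ⟨H, _, _, _, π, hinj, hconc, hσ⟩ := SigmaStarAlgebra.exists_faithful_rep (A := A)
  let s : Set H := {η | ∃ c ∈ S, ∃ ξ : H, η = π c ξ}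
  have hs : Dense (Submodule.span ℂ s : Set H) := by
    -- Let `ξ` be orthogonal to all `π(c)H` with `c ∈ S`. The `c` with this property form a
    -- `σ`-closed set, hence all of `A`, and nondegeneracy gives `ξ = 0`.
    rw [Submodule.dense_iff_topologicalClosure_eq_top, Submodule.topologicalClosure_eq_top_iff,
      Submodule.eq_bot_iff]
    intro ξ hξ
    have hmem : ∀ c : A, ∀ η, inner ℂ ξ (π c η) = 0 := by
      refine hS.mem_of_isSigmaClosed (T := {c | ∀ η, inner ℂ ξ (π c η) = 0}) ?_ ?_
      · intro c hc η
        exact (Submodule.mem_orthogonal' _ _).1 hξ _ (Submodule.subset_span ⟨c, hc, η, rfl⟩)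
      · intro c l hc hl η
        rw [hσ, wotTendsto_iff] at hl
        refine tendsto_nhds_unique (hl η ξ) ?_
        simp only [show ∀ n, inner ℂ ξ (π (c n) η) = 0 from fun n => hc n η]
        exact tendsto_const_nhds
    have hperp : ξ ∈ (Submodule.span ℂ
        {η : H | ∃ T ∈ NonUnitalStarAlgHom.range π, ∃ ζ : H, η = T ζ})ᗮ := by
      rw [Submodule.mem_orthogonal']
      intro η hη
      induction hη using Submodule.span_induction with
      | mem η hη =>
        obtain ⟨_, ⟨c, rfl⟩, ζ, rfl⟩ := hη
        exact hmem c ζ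
      | zero => simp
      | add x z _ _ hx hz => rw [inner_add_right, hx, hz, add_zero]
      | smul c x _ hx => rw [inner_smul_right, hx, mul_zero]
    rwa [Submodule.topologicalClosure_eq_top_iff.1
      (Submodule.dense_iff_topologicalClosure_eq_top.1 hconc.nondegenerate),
      Submodule.mem_bot] at hperp
  obtain ⟨T, hT⟩ := exists_wotTendsto (fun n => π (b n)) C
    (fun n => (NonUnitalStarAlgHom.norm_map π hinj (b n)).trans_le (hC n)) s hs (by
      rintro _ ⟨c, hc, ξ, rfl⟩ y
      obtain ⟨l, hl⟩ := hb c hc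
      rw [hσ, wotTendsto_iff] at hl
      simpa using (hl ξ y).cauchySeq)
  obtain ⟨l, hl⟩ := hconc.wot_seq_closed _ T (fun n => ⟨b n, rfl⟩) hT
  exact ⟨l, (hσ _ _).2 (by simpa [show π l = T from hl] using hT)⟩

theorem isSigmaDense_univ : IsSigmaDense (Set.univ : Set A) :=
  Set.eq_univ_of_univ_subset (Set.subset_sInter fun _ hT => hT.1)

/-- A sequence that `σ`-converges after multiplication by every element is `σ`-convergent. -/
theorem exists_sigmaTendsto_of_forall_mul {b : ℕ → A}
    (hb : ∀ c, ∃ l, SigmaTendsto (fun n => b n * c) l) : ∃ l, SigmaTendsto b l := by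
  -- Uniform boundedness for the left multiplications by `b n` supplies the missing norm bound.
  obtain ⟨C, hC⟩ := banach_steinhaus (g := fun n => ContinuousLinearMap.mul ℂ A (b n)) fun c => by
    obtain ⟨l, hl⟩ := hb c
    exact hl.exists_norm_le
  refine exists_sigmaTendsto_of_norm_le isSigmaDense_univ (C := C) (fun n => ?_) fun c _ => hb c
  simpa using hC n

omit [SigmaStarAlgebra A] in
theorem span_star_mul_self_eq_top : Submodule.span ℂ {a : A | ∃ x, a = star x * x} = ⊤ := by
  let _ := CStarAlgebra.spectralOrder A
  let _ := CStarAlgebra.spectralOrderedRing A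
  rw [← CStarAlgebra.span_nonneg (A := A)]
  congr 1
  ext a
  exact CStarAlgebra.nonneg_iff_eq_star_mul_self.symm

end SigmaStarAlgebra

open SigmaStarAlgebra

/-! ### Elementary identities in `C*`-modules -/

namespace RightCStarModule

variable {B : Type v} [NonUnitalCStarAlgebra B] {X : Type w} [AddCommGroup X] [Module ℂ X]
  (M : RightCStarModule B X)

theorem act_zero (x : X) : M.act x 0 = 0 := by
  simpa using M.act_smul 0 x 0

theorem act_sub (x : X) (b c : B) : M.act x (b - c) = M.act x b - M.act x c := by
  rw [eq_sub_iff_add_eq, ← M.act_add, sub_add_cancel]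

theorem sub_act (x y : X) (b : B) : M.act (x - y) b = M.act x b - M.act y b := by
  rw [eq_sub_iff_add_eq, ← M.add_act, sub_add_cancel]

theorem inner_sub_right (x y z : X) : M.inner x (y - z) = M.inner x y - M.inner x z := by
  rw [eq_sub_iff_add_eq, ← M.inner_add_right, sub_add_cancel]

theorem inner_zero_right (x : X) : M.inner x 0 = 0 := by
  simpa using M.inner_smul_right 0 x 0

theorem inner_act_left (x y : X) (b : B) : M.inner (M.act x b) y = star b * M.inner x y := by
  rw [← M.star_inner, M.inner_act_right, star_mul, M.star_inner]

theorem eq_of_forall_inner {x y : X} (h : ∀ z, M.inner z x = M.inner z y) : x = y := by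
  rw [← sub_eq_zero]
  refine M.inner_self_eq_zero _ ?_
  rw [M.inner_sub_right, h, sub_self]

/-- An element annihilating a `σ`-full module is zero. -/
theorem eq_zero_of_forall_act_eq_zero [SigmaStarAlgebra B] (hM : M.IsSigmaFull) {b : B}
    (h : ∀ x, M.act x b = 0) : b = 0 := by
  refine eq_zero_of_forall_mul_eq_zero hM fun c hc => ?_
  induction hc using Submodule.span_induction with
  | mem c hc =>
    obtain ⟨x, y, rfl⟩ := hc
    rw [← M.inner_act_right, h, M.inner_zero_right]
  | zero => simp
  | add x y _ _ hx hy => rw [add_mul, hx, hy, add_zero]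
  | smul z x _ hx => rw [smul_mul_assoc, hx, smul_zero]

end RightCStarModule

namespace LeftCStarModule

variable {A : Type u} [NonUnitalCStarAlgebra A] {X : Type w} [AddCommGroup X] [Module ℂ X]
  (M : LeftCStarModule A X)

theorem inner_act_right (a : A) (x y : X) : M.inner x (M.act a y) = M.inner x y * star a := by
  rw [← M.star_inner, M.inner_act_left, star_mul, M.star_inner]

theorem zero_act (x : X) : M.act 0 x = 0 := by
  simpa using M.smul_act 0 0 x

end LeftCStarModule

/-! ### The commutation identity and the exchange of sides -/

namespace SigmaImprimitivityBimodule

variable {A : Type u} {B : Type v} [NonUnitalCommCStarAlgebra A] [SigmaStarAlgebra A]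
  [NonUnitalCommCStarAlgebra B] [SigmaStarAlgebra B] {X : Type w} [AddCommGroup X] [Module ℂ X]
  (E : SigmaImprimitivityBimodule A B X)

/-- The cyclic symmetry of `x⟨y|z⟩⟨w|v⟩` in `x, z, v`. -/
theorem act_inner_act_inner_cycle (x y z w v : X) :
    E.right.act (E.right.act x (E.right.inner y z)) (E.right.inner w v) =
      E.right.act (E.right.act z (E.right.inner y v)) (E.right.inner w x) := by
  -- Both sides become products of two inner products acting on one vector; factors are exchanged
  -- once in `A` and once in `B`.
  rw [← E.inner_act x y z, E.act_act, ← E.inner_act z w v, ← E.left.mul_act, mul_comm,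
    E.left.mul_act, E.inner_act x y v, ← E.act_act, E.inner_act z w x, ← E.right.act_mul, mul_comm,
    E.right.act_mul]

/-- In a bimodule over commutative algebras, `x⟨y|z⟩ = z⟨y|x⟩`. -/
theorem act_inner_comm (x y z : X) :
    E.right.act x (E.right.inner y z) = E.right.act z (E.right.inner y x) := by
  -- The difference `u` is killed by every `⟨y|v⟩`: take `w = y` in the cyclic identity.
  have hu : ∀ v, E.right.act (E.right.act x (E.right.inner y z) -
      E.right.act z (E.right.inner y x)) (E.right.inner y v) = 0 := by
    intro v
    rw [E.right.sub_act, sub_eq_zero, E.act_inner_act_inner_cycle, ← E.right.act_mul, mul_comm,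
      E.right.act_mul]
  rw [← sub_eq_zero]
  generalize hdef : E.right.act x (E.right.inner y z) - E.right.act z (E.right.inner y x) = u
    at hu ⊢
  refine E.right.inner_self_eq_zero _ (CStarRing.star_mul_self_eq_zero_iff _ |>.1 ?_)
  rw [E.right.star_inner]
  have h1 : ∀ v, E.right.inner u u * E.right.inner y v = 0 := fun v => by
    rw [← E.right.inner_act_right, hu, E.right.inner_zero_right]
  have h2 : E.right.inner u u =
      E.right.inner u x * E.right.inner y z - E.right.inner u z * E.right.inner y x := by
    nth_rw 2 [← hdef]
    rw [E.right.inner_sub_right, E.right.inner_act_right, E.right.inner_act_right]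
  -- Expanding one factor of `⟨u|u⟩²` leaves multiples of `⟨u|u⟩⟨y|z⟩` and `⟨u|u⟩⟨y|x⟩`, both zero
  -- by `h1`.
  nth_rw 2 [h2]
  rw [mul_sub, mul_left_comm, h1, mul_left_comm, h1]
  simp

theorem left_inner_act (x y z : X) :
    E.left.act (E.left.inner x y) z = E.right.act z (E.right.inner y x) := by
  rw [E.inner_act, E.act_inner_comm]

/-- Both sides act equally on any `z`: `z⟨ax|y⟩` equals the left inner product of `z` and `ax`
applied to `y`, where `a` moves out as `star a`. Fullness then gives equality. -/
theorem right_inner_left_act (a : A) (x y : X) :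
    E.right.inner (E.left.act a x) y = E.right.inner x (E.left.act (star a) y) := by
  rw [← sub_eq_zero]
  refine E.right.eq_zero_of_forall_act_eq_zero E.right_isSigmaFull fun z => ?_
  rw [E.right.act_sub, ← E.inner_act, ← E.inner_act, E.left.inner_act_right, E.left.mul_act,
    sub_self]

/-- The bimodule with the two sides exchanged. -/
noncomputable def flip : SigmaImprimitivityBimodule B A X where
  left :=
    { act := fun b x => E.right.act x b
      inner := fun x y => E.right.inner y x
      act_add := fun b x y => E.right.add_act x y b
      add_act := fun a b x => E.right.act_add x a b
      mul_act := fun a b x => by rw [mul_comm, E.right.act_mul]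
      act_smul := fun z a x => E.right.smul_act z x a
      smul_act := fun z a x => E.right.act_smul z x a
      inner_add_left := fun x y z => E.right.inner_add_right z x y
      inner_smul_left := fun c x y => E.right.inner_smul_right c y x
      inner_act_left := fun a x y => by rw [E.right.inner_act_right, mul_comm]
      star_inner := fun x y => E.right.star_inner y x
      inner_self_positive := E.right.inner_self_positive
      inner_self_eq_zero := E.right.inner_self_eq_zero
      complete := E.right.complete }
  right :=
    { act := fun x a => E.left.act a x
      inner := fun x y => E.left.inner y x
      add_act := fun x y a => E.left.act_add a x y
      act_add := fun x a b => E.left.add_act a b x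
      act_mul := fun x a b => by rw [mul_comm, E.left.mul_act]
      smul_act := fun z x a => E.left.act_smul z a x
      act_smul := fun z x a => E.left.smul_act z a x
      inner_add_right := fun x y z => E.left.inner_add_left y z x
      inner_smul_right := fun c x y => E.left.inner_smul_left c y x
      inner_act_right := fun x y a => by rw [E.left.inner_act_left, mul_comm]
      star_inner := fun x y => E.left.star_inner y x
      inner_self_positive := E.left.inner_self_positive
      inner_self_eq_zero := E.left.inner_self_eq_zero
      complete := E.left.complete }
  act_act := fun b x a => (E.act_act a x b).symm
  left_isSigmaModule := fun x hx => by
    obtain ⟨l, hl⟩ := E.right_isSigmaModule x fun y => by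
      obtain ⟨b, hb⟩ := hx y
      exact ⟨star b, by simpa only [E.right.star_inner] using hb.star⟩
    exact ⟨l, fun y => by simpa only [E.right.star_inner] using (hl y).star⟩
  right_isSigmaModule := fun x hx => by
    obtain ⟨l, hl⟩ := E.left_isSigmaModule x fun y => by
      obtain ⟨b, hb⟩ := hx y
      exact ⟨star b, by simpa only [E.left.star_inner] using hb.star⟩
    exact ⟨l, fun y => by simpa only [E.left.star_inner] using (hl y).star⟩
  left_isSigmaFull := by
    have h := E.right_isSigmaFull
    unfold RightCStarModule.IsSigmaFull at h
    unfold LeftCStarModule.IsSigmaFull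
    convert h using 4
    exact funext fun _ => propext exists_comm
  right_isSigmaFull := by
    have h := E.left_isSigmaFull
    unfold LeftCStarModule.IsSigmaFull at h
    unfold RightCStarModule.IsSigmaFull
    convert h using 4
    exact funext fun _ => propext exists_comm
  inner_act := fun x y z => (E.inner_act z y x).symm
  tendsto_iff := fun x l => by
    refine Iff.trans ?_ ((E.tendsto_iff x l).symm.trans ?_)
    · exact forall_congr' fun y => ⟨fun h => by simpa only [E.right.star_inner] using h.star,
        fun h => by simpa only [E.right.star_inner] using h.star⟩
    · exact forall_congr' fun y => ⟨fun h => by simpa only [E.left.star_inner] using h.star,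
        fun h => by simpa only [E.left.star_inner] using h.star⟩

/-! ### The correspondence between elements of the two algebras -/

/-- `a` acts from the left as `b` acts from the right. -/
def Corresponds (a : A) (b : B) : Prop :=
  ∀ x, E.left.act a x = E.right.act x b

variable {E}

theorem Corresponds.star {a : A} {b : B} (h : E.Corresponds a b) :
    E.Corresponds (star a) (star b) := fun x =>
  E.right.eq_of_forall_inner fun y => by
    rw [← E.right_inner_left_act, h, E.right.inner_act_left, E.right.inner_act_right, mul_comm]

theorem Corresponds.eq {a : A} {b c : B} (hb : E.Corresponds a b) (hc : E.Corresponds a c) :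
    b = c := by
  rw [← sub_eq_zero]
  refine E.right.eq_zero_of_forall_act_eq_zero E.right_isSigmaFull fun x => ?_
  rw [E.right.act_sub, ← hb, ← hc, sub_self]

theorem Corresponds.add {a a' : A} {b b' : B} (h : E.Corresponds a b) (h' : E.Corresponds a' b') :
    E.Corresponds (a + a') (b + b') := fun x => by
  rw [E.left.add_act, E.right.act_add, h, h']

theorem Corresponds.mul {a a' : A} {b b' : B} (h : E.Corresponds a b) (h' : E.Corresponds a' b') :
    E.Corresponds (a * a') (b * b') := fun x => by
  rw [E.left.mul_act, mul_comm b, E.right.act_mul, h, h']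

theorem Corresponds.smul {a : A} {b : B} (h : E.Corresponds a b) (z : ℂ) :
    E.Corresponds (z • a) (z • b) := fun x => by
  rw [E.left.smul_act, E.right.act_smul, h]

variable (E)

theorem corresponds_zero : E.Corresponds 0 0 := fun x => by
  rw [E.left.zero_act, E.right.act_zero]

theorem corresponds_flip {a : A} {b : B} : E.flip.Corresponds b a ↔ E.Corresponds a b :=
  forall_congr' fun _ => eq_comm

variable {E}

/-- If `aₙ → a` in `A` and `bₙ` acts as `aₙ`, then `bₙ⟨x|y⟩ → ⟨x|ay⟩` in `B`. -/
theorem sigmaTendsto_mul_inner {a : ℕ → A} {b : ℕ → B} {l : A} (h : ∀ n, E.Corresponds (a n) (b n))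
    (ha : SigmaTendsto a l) (x y : X) :
    SigmaTendsto (fun n => b n * E.right.inner x y) (E.right.inner x (E.left.act l y)) := by
  -- Convergence is visible on the left, since `⟨aₙy|z⟩ = aₙ⟨y|z⟩`; condition (3) carries it over to
  -- the right inner product.
  have h1 : E.left.ModSigmaTendsto (fun n => E.left.act (a n) y) (E.left.act l y) := fun z => by
    simpa only [E.left.inner_act_left] using ha.mul_const (E.left.inner y z)
  have h2 := ((E.tendsto_iff _ _).1 h1 x).star
  simpa only [E.right.star_inner, h _ _, E.right.inner_act_right, mul_comm] using h2

theorem corresponds_of_forall_sigmaTendsto {a : ℕ → A} {b : ℕ → B} {l : A} {m : B}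
    (h : ∀ n, E.Corresponds (a n) (b n)) (ha : SigmaTendsto a l) (hb : SigmaTendsto b m) :
    E.Corresponds l m := fun x =>
  E.right.eq_of_forall_inner fun y => by
    rw [E.right.inner_act_right, mul_comm]
    exact (sigmaTendsto_mul_inner h ha y x).unique (hb.mul_const _)

variable (E)

/-- The graph of the correspondence, as a `*`-subalgebra of `A × B`. -/
def correspondence : NonUnitalStarSubalgebra ℂ (A × B) where
  carrier := {p | E.Corresponds p.1 p.2}
  add_mem' := fun h h' => h.add h'
  zero_mem' := E.corresponds_zero
  mul_mem' := fun h h' => h.mul h'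
  smul_mem' := fun z _ h => h.smul z
  star_mem' := fun h => h.star

theorem isClosed_correspondence : IsClosed (E.correspondence : Set (A × B)) :=
  isClosed_of_closure_subset fun p hp => by
    obtain ⟨q, hq, hlim⟩ := mem_closure_iff_seq_limit.1 hp
    exact corresponds_of_forall_sigmaTendsto hq
      (sigmaTendsto_of_tendsto ((continuous_fst.tendsto p).comp hlim))
      (sigmaTendsto_of_tendsto ((continuous_snd.tendsto p).comp hlim))

variable {E}

/-- The closed graph is a `C*`-algebra with the maximum norm, and its injective projection to `A` is
isometric. -/
theorem Corresponds.norm_le {a : A} {b : B} (h : E.Corresponds a b) : ‖b‖ ≤ ‖a‖ := by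
  have := E.isClosed_correspondence
  let π : E.correspondence →⋆ₙₐ[ℂ] A :=
    (NonUnitalStarAlgHom.fst ℂ A B).comp (NonUnitalStarSubalgebraClass.subtype E.correspondence)
  have hπ : Function.Injective π := by
    rintro ⟨⟨a, b⟩, hp⟩ ⟨⟨a', b'⟩, hq⟩ hpq
    obtain rfl : a = a' := hpq
    obtain rfl : b = b' := Corresponds.eq hp hq
    rfl
  have hn : ‖a‖ = ‖((a, b) : A × B)‖ :=
    NonUnitalStarAlgHom.norm_map π hπ (⟨(a, b), h⟩ : E.correspondence)
  exact hn ▸ le_max_right _ _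

/-- The algebra elements with a counterpart on the other side are `σ`-closed, and passing to the
counterpart is `σ`-continuous. -/
theorem Corresponds.exists_sigmaTendsto {a : ℕ → A} {b : ℕ → B} {l : A}
    (h : ∀ n, E.Corresponds (a n) (b n)) (ha : SigmaTendsto a l) :
    ∃ m, SigmaTendsto b m ∧ E.Corresponds l m := by
  obtain ⟨C, hC⟩ := ha.exists_norm_le
  obtain ⟨m, hm⟩ : ∃ m, SigmaTendsto b m := by
    refine exists_sigmaTendsto_of_norm_le E.right_isSigmaFull
      (fun n => (h n).norm_le.trans (hC n)) fun c hc => ?_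
    induction hc using Submodule.span_induction with
    | mem c hc =>
      obtain ⟨x, y, rfl⟩ := hc
      exact ⟨_, sigmaTendsto_mul_inner h ha x y⟩
    | zero => exact ⟨0, by simpa using sigmaTendsto_of_tendsto tendsto_const_nhds⟩
    | add c d _ _ hc hd =>
      obtain ⟨p, hp⟩ := hc
      obtain ⟨q, hq⟩ := hd
      exact ⟨p + q, by simpa only [mul_add] using hp.add hq⟩
    | smul z c _ hc =>
      obtain ⟨p, hp⟩ := hc
      exact ⟨z • p, by simpa only [mul_smul_comm] using hp.const_smul z⟩
  exact ⟨m, hm, corresponds_of_forall_sigmaTendsto h ha hm⟩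

variable (E)

/-- The elements of `A` that have a counterpart form a `σ`-closed set containing the span of the
inner products. -/
theorem exists_corresponds (a : A) : ∃ b, E.Corresponds a b := by
  refine E.left_isSigmaFull.mem_of_isSigmaClosed (T := {a | ∃ b, E.Corresponds a b}) ?_ ?_ a
  · intro a ha
    induction ha using Submodule.span_induction with
    | mem a ha =>
      obtain ⟨x, y, rfl⟩ := ha
      exact ⟨E.right.inner y x, E.left_inner_act x y⟩
    | zero => exact ⟨0, E.corresponds_zero⟩
    | add a a' _ _ h h' =>
      obtain ⟨b, hb⟩ := h
      obtain ⟨b', hb'⟩ := h'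
      exact ⟨_, hb.add hb'⟩
    | smul z a _ h =>
      obtain ⟨b, hb⟩ := h
      exact ⟨_, hb.smul z⟩
  · intro a l ha hl
    choose b hb using ha
    obtain ⟨m, -, hm⟩ := Corresponds.exists_sigmaTendsto hb hl
    exact ⟨m, hm⟩

/-- Existence of the isomorphism of the coefficient algebras induced by a bimodule. -/
theorem exists_starAlgEquiv : ∃ φ : A ≃⋆ₐ[ℂ] B, IsSigmaStarIso φ ∧ ∀ a, E.Corresponds a (φ a) := by
  choose f hf using E.exists_corresponds
  choose g hg using E.flip.exists_corresponds
  simp only [corresponds_flip] at hg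
  let φ : A ≃⋆ₐ[ℂ] B :=
    { toFun := f
      invFun := g
      left_inv := fun a => Corresponds.eq (E := E.flip) (E.corresponds_flip.2 (hg (f a)))
        (E.corresponds_flip.2 (hf a))
      right_inv := fun b => (hf (g b)).eq (hg b)
      map_mul' := fun a a' => (hf _).eq ((hf a).mul (hf a'))
      map_add' := fun a a' => (hf _).eq ((hf a).add (hf a'))
      map_star' := fun a => (hf _).eq (hf a).star
      map_smul' := fun z a => (hf _).eq ((hf a).smul z) }
  refine ⟨φ, ⟨fun a l hl => ?_, fun b l hl => ?_⟩, hf⟩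
  · obtain ⟨m, hm, hlm⟩ := Corresponds.exists_sigmaTendsto (fun n => hf (a n)) hl
    rwa [show φ l = m from (hf l).eq hlm]
  · obtain ⟨m, hm, hlm⟩ := Corresponds.exists_sigmaTendsto (E := E.flip)
      (fun n => E.corresponds_flip.2 (hg (b n))) hl
    rwa [show φ.symm l = m from (E.corresponds_flip.2 (hg l)).eq hlm]

end SigmaImprimitivityBimodule

/-! ### The bimodule of an isomorphism -/

section Model

variable {A : Type u} {B : Type v} [NonUnitalCommCStarAlgebra A]
  [NonUnitalCommCStarAlgebra B]

/-- Completeness of both module structures reduces to that of `A`, since each module norm is the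
norm of `A`. -/
theorem ULift.exists_tendsto_of_sqrt_norm {C : Type*} [Norm C] (f : ULift.{v} A → C)
    (hf : ∀ x, √‖f x‖ = ‖x.down‖) (x : ℕ → ULift.{v} A)
    (hx : ∀ ε > 0, ∃ N, ∀ m ≥ N, ∀ n ≥ N, √‖f (x m - x n)‖ < ε) :
    ∃ l, Tendsto (fun n => √‖f (x n - l)‖) atTop (𝓝 0) := by
  simp only [hf] at hx ⊢
  obtain ⟨l, hl⟩ := cauchySeq_tendsto_of_complete (u := fun n => (x n).down)
    (Metric.cauchySeq_iff.2 fun ε hε => by simpa [dist_eq_norm] using hx ε hε)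
  exact ⟨⟨l⟩, tendsto_iff_norm_sub_tendsto_zero.1 hl⟩

variable (A) in
/-- A commutative `C*`-algebra as a left `C*`-module over itself. -/
noncomputable def selfLeftCStarModule : LeftCStarModule A (ULift.{v} A) where
  act a x := ⟨a * x.down⟩
  inner x y := x.down * star y.down
  act_add a x y := ULift.ext _ _ (mul_add a x.down y.down)
  add_act a b x := ULift.ext _ _ (add_mul a b x.down)
  mul_act a b x := ULift.ext _ _ (mul_assoc a b x.down)
  act_smul z a x := ULift.ext _ _ (mul_smul_comm z a x.down)
  smul_act z a x := ULift.ext _ _ (smul_mul_assoc z a x.down)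
  inner_add_left x y z := add_mul x.down y.down _
  inner_smul_left z x y := smul_mul_assoc z x.down _
  inner_act_left a x y := mul_assoc a x.down _
  star_inner x y := by simp [mul_comm]
  inner_self_positive x := ⟨star x.down, by simp⟩
  inner_self_eq_zero x hx := ULift.ext _ _ (CStarRing.mul_star_self_eq_zero_iff _ |>.1 hx)
  complete := ULift.exists_tendsto_of_sqrt_norm (fun x => x.down * star x.down) fun x => by
    rw [CStarRing.norm_self_mul_star, Real.sqrt_mul_self (norm_nonneg _)]

/-- The domain of a `*`-isomorphism onto `B` as a right `C*`-module over `B`. -/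
noncomputable def StarAlgEquiv.rightCStarModule (φ : A ≃⋆ₐ[ℂ] B) :
    RightCStarModule B (ULift.{v} A) where
  act x b := ⟨x.down * φ.symm b⟩
  inner x y := φ (star x.down * y.down)
  add_act x y b := ULift.ext _ _ (add_mul x.down y.down _)
  act_add x b c := ULift.ext _ _ (by simp [mul_add])
  act_mul x b c := ULift.ext _ _ (by simp [mul_assoc])
  smul_act z x b := ULift.ext _ _ (smul_mul_assoc z x.down _)
  act_smul z x b := ULift.ext _ _ (by simp [map_smul, mul_smul_comm])
  inner_add_right x y z := by simp [mul_add]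
  inner_smul_right z x y := by simp [map_smul, mul_smul_comm]
  inner_act_right x y b := by simp [mul_assoc]
  star_inner x y := by rw [← map_star, star_mul, star_star]
  inner_self_positive x := ⟨φ x.down, by rw [map_mul, map_star]⟩
  inner_self_eq_zero x hx := by
    rw [map_mul, map_star, CStarRing.star_mul_self_eq_zero_iff] at hx
    exact ULift.ext _ _ ((map_eq_zero_iff φ φ.injective).1 hx)
  complete := ULift.exists_tendsto_of_sqrt_norm (fun x => φ (star x.down * x.down)) fun x => by
    rw [StarAlgEquiv.norm_map, CStarRing.norm_star_mul_self, Real.sqrt_mul_self (norm_nonneg _)]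

variable [SigmaStarAlgebra A] [SigmaStarAlgebra B]

theorem sigmaTendsto_map_iff {φ : A ≃⋆ₐ[ℂ] B} (hφ : IsSigmaStarIso φ) {a : ℕ → A} {l : A} :
    SigmaTendsto (fun n => φ (a n)) (φ l) ↔ SigmaTendsto a l :=
  ⟨fun h => by simpa using hφ.continuous_symm _ _ h, hφ.continuous_toFun a l⟩

theorem selfLeftCStarModule_modSigmaTendsto_iff (x : ℕ → ULift.{v} A) (l : ULift.{v} A) :
    (selfLeftCStarModule A).ModSigmaTendsto x l ↔
      ∀ c, SigmaTendsto (fun n => (x n).down * c) (l.down * c) :=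
  ⟨fun h c => by simpa [selfLeftCStarModule] using h ⟨star c⟩, fun h y => h (star y.down)⟩

theorem rightCStarModule_modSigmaTendsto_iff {φ : A ≃⋆ₐ[ℂ] B} (hφ : IsSigmaStarIso φ)
    (x : ℕ → ULift.{v} A) (l : ULift.{v} A) :
    φ.rightCStarModule.ModSigmaTendsto x l ↔
      ∀ c, SigmaTendsto (fun n => (x n).down * c) (l.down * c) := by
  have h1 : φ.rightCStarModule.ModSigmaTendsto x l ↔ ∀ y : ULift.{v} A,
      SigmaTendsto (fun n => star (x n).down * y.down) (star l.down * y.down) :=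
    forall_congr' fun y => sigmaTendsto_map_iff hφ (a := fun n => star (x n).down * y.down)
  rw [h1]
  refine ⟨fun h c => ?_, fun h y => ?_⟩
  · simpa [mul_comm] using (h ⟨star c⟩).star
  · simpa [mul_comm] using (h (star y.down)).star

theorem selfLeftCStarModule_isSigmaModule :
    (selfLeftCStarModule.{u, v} A).IsSigmaModule := fun x hx => by
  obtain ⟨l, hl⟩ := exists_sigmaTendsto_of_forall_mul (b := fun n => (x n).down) fun c => by
    simpa [selfLeftCStarModule] using hx ⟨star c⟩
  exact ⟨⟨l⟩, fun y => hl.mul_const _⟩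

theorem rightCStarModule_isSigmaModule {φ : A ≃⋆ₐ[ℂ] B} (hφ : IsSigmaStarIso φ) :
    φ.rightCStarModule.IsSigmaModule := fun x hx => by
  obtain ⟨l, hl⟩ := exists_sigmaTendsto_of_forall_mul (b := fun n => (x n).down) fun c => by
    obtain ⟨b, hb⟩ := hx ⟨star c⟩
    have h1 := (hφ.continuous_symm _ _ hb).star
    exact ⟨star (φ.symm b), by simpa [StarAlgEquiv.rightCStarModule, mul_comm] using h1⟩
  exact ⟨⟨l⟩, (rightCStarModule_modSigmaTendsto_iff hφ x ⟨l⟩).2 fun c => hl.mul_const c⟩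

/-- Positive elements already span a `C*`-algebra, so no limits are needed. -/
theorem isSigmaDense_span_of_star_mul_self_mem {S : Set A} (hS : ∀ a, star a * a ∈ S) :
    IsSigmaDense (Submodule.span ℂ S : Set A) := by
  have h : Submodule.span ℂ S = ⊤ := by
    rw [eq_top_iff, ← span_star_mul_self_eq_top]
    refine Submodule.span_mono ?_
    rintro _ ⟨x, rfl⟩
    exact hS x
  rw [h, Submodule.top_coe]
  exact isSigmaDense_univ

/-- A `Σ*`-isomorphism of commutative `Σ*`-algebras turns its domain into an imprimitivity
bimodule. -/
noncomputable def IsSigmaStarIso.bimodule {φ : A ≃⋆ₐ[ℂ] B} (hφ : IsSigmaStarIso φ) :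
    SigmaImprimitivityBimodule A B (ULift.{v} A) where
  left := selfLeftCStarModule A
  right := φ.rightCStarModule
  act_act a x b := ULift.ext _ _ (mul_assoc a x.down _)
  left_isSigmaModule := selfLeftCStarModule_isSigmaModule
  right_isSigmaModule := rightCStarModule_isSigmaModule hφ
  left_isSigmaFull := isSigmaDense_span_of_star_mul_self_mem fun a =>
    ⟨⟨a⟩, ⟨a⟩, mul_comm _ _⟩
  right_isSigmaFull := isSigmaDense_span_of_star_mul_self_mem fun b =>
    ⟨⟨φ.symm b⟩, ⟨φ.symm b⟩, by simp [StarAlgEquiv.rightCStarModule, map_star]⟩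
  inner_act x y z := ULift.ext _ _ (by
    simp [selfLeftCStarModule, StarAlgEquiv.rightCStarModule, mul_assoc])
  tendsto_iff x l := (selfLeftCStarModule_modSigmaTendsto_iff x l).trans
    (rightCStarModule_modSigmaTendsto_iff hφ x l).symm

end Model

theorem mainTheorem7 {A : Type u} {B : Type v} [NonUnitalCommCStarAlgebra A] [SigmaStarAlgebra A]
    [NonUnitalCommCStarAlgebra B] [SigmaStarAlgebra B] :
    (StronglySigmaMoritaEquivalent A B ↔ ∃ φ : A ≃⋆ₐ[ℂ] B, IsSigmaStarIso φ) ∧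
    ∀ (X : Type w) [AddCommGroup X] [Module ℂ X] (E : SigmaImprimitivityBimodule A B X),
      ∃ φ : A ≃⋆ₐ[ℂ] B, IsSigmaStarIso φ ∧
        (∀ (a : A) (x : X), E.left.act a x = E.right.act x (φ a)) ∧
        ∀ (a : A) (b : B), (∀ x : X, E.left.act a x = E.right.act x b) → b = φ a := by
  refine ⟨⟨?_, ?_⟩, fun X _ _ E => ?_⟩
  · rintro ⟨X, _, _, ⟨E⟩⟩
    obtain ⟨φ, hφ, -⟩ := E.exists_starAlgEquiv
    exact ⟨φ, hφ⟩
  · rintro ⟨φ, hφ⟩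
    -- Lifting places the module in the universe `max u v`.
    exact ⟨ULift.{v} A, inferInstance, inferInstance, ⟨hφ.bimodule⟩⟩
  · obtain ⟨φ, hφ, h⟩ := E.exists_starAlgEquiv
    exact ⟨φ, hφ, h, fun a b hab => SigmaImprimitivityBimodule.Corresponds.eq hab (h a)⟩
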